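/- Let $k$ be a finite field of characteristic $p$, let $k_1\langle X\rangle$ be the free unital associative $k$-algebra on the countably infinite set $X=\{x_1,x_2,\dots\}$, and let $G$ be the infinite dimensional unital Grassmann algebra over $k$, generated by $e_1,e_2,\dots$ subject to $e_ie_j=-e_je_i$ and $e_i^2=0$ for all $i,j\ge 1$. A $T$-space is a $k$-linear subspace of $k_1\langle X\rangle$ that is invariant under all (unital) algebra endomorphisms of $k_1\langle X\rangle$; for $B\subseteq k_1\langle X\rangle$ let $B^S$ denote the smallest $T$-space containing $B$. Let $T(G)$ be the set of all $f\in k_1\langle X\rangle$ that are sent to $0$ by every unital $k$-algebra homomorphism $k_1\langle X\rangle\to G$. A central polynomial of $G$ is an element $f\in k_1\langle X\rangle\setminus T(G)$ whose image under every unital $k$-algebra homomorphism $k_1\langle X\rangle\to G$ lies in the centre of $G$; let $CP(G)$ be the $T$-space generated by all central polynomials of $G$. Write $[a,b]=ab-ba$ and $$S_1=\{[x_1,x_2],\;x_1^p\}^S+\Bigl\{\,x_1^p\prod_{i=1}^t[x_{2i},x_{2i+1}]\,x_{2i}^{p-1}x_{2i+1}^{p-1}\;\Bigm|\;t\ge 1\Bigr\}^S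 .$$ If $p>2$, then $CP(G)=S_1+T(G)$. If $p=2$, then $CP(G)=k_1\langle X\rangle$. -/

import Mathlib

namespace GrassmannPI

section TSpaces

variable {k A : Type*} [Field k] [Ring A] [Algebra k A]

/-- A linear subspace of a unital `k`-algebra is a `T`-space if it is invariant under every
endomorphism of the algebra. -/
def IsTSpace (V : Submodule k A) : Prop :=
  ∀ φ : A →ₐ[k] A, ∀ f ∈ V, φ f ∈ V

/-- The smallest `T`-space containing the set `B`. -/
def tSpan (k : Type*) {A : Type*} [Field k] [Ring A] [Algebra k A] (B : Set A) :
    Submodule k A :=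
  sInf {V : Submodule k A | IsTSpace V ∧ B ⊆ V}

theorem isTSpace_tSpan (B : Set A) : IsTSpace (tSpan k B) := by
  intro φ f hf
  simp only [tSpan, Submodule.mem_sInf] at hf ⊢
  exact fun V hV => hV.1 φ f (hf V hV)

theorem subset_tSpan (B : Set A) : B ⊆ tSpan k B := by
  intro f hf
  simp only [tSpan, SetLike.mem_coe, Submodule.mem_sInf]
  exact fun V hV => hV.2 hf

end TSpaces

/-- The free unital associative `k`-algebra on countably many variables. -/
abbrev FreeAlg (k : Type*) [Field k] : Type _ := FreeAlgebra k ℕ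

/-- The free variables. They are numbered from `0` here, so `X k j` is the variable usually
written `x_{j+1}`. -/
def X (k : Type*) [Field k] (j : ℕ) : FreeAlg k := FreeAlgebra.ι k j

section Identities

variable (k A : Type*) [Field k] [Ring A] [Algebra k A]

/-- The polynomial identities of the unital algebra `A` (together with `0`): the elements of the
free algebra that every unital algebra homomorphism to `A` sends to `0`. -/
def identities : Submodule k (FreeAlg k) :=
  ⨅ φ : FreeAlg k →ₐ[k] A, LinearMap.ker φ.toLinearMap

/-- A central polynomial of `A`: not an identity, and all its values in `A` are central. -/
def IsCentralPolynomial (f : FreeAlg k) : Prop :=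
  f ∉ identities k A ∧ ∀ φ : FreeAlg k →ₐ[k] A, φ f ∈ Subalgebra.center k A

/-- The `T`-space generated by all central polynomials of `A`. -/
def CP : Submodule k (FreeAlg k) :=
  tSpan k {f | IsCentralPolynomial k A f}

end Identities

/-- The unital Grassmann algebra on countably many generators `e_i`, over a field `k` of any
characteristic (`e_i * e_i = 0` also in characteristic two). -/
abbrev Grassmann (k : Type*) [Field k] : Type _ := ExteriorAlgebra k (ℕ →₀ k)

/-- The element `x_1^p ∏_{i=1}^t [x_{2i}, x_{2i+1}] x_{2i}^{p-1} x_{2i+1}^{p-1}`; the product is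
taken from left to right, and its factor number `i + 1` is the one written for `i` below. -/
def gen (k : Type*) [Field k] (p t : ℕ) : FreeAlg k :=
  X k 0 ^ p *
    ((List.range t).map fun i =>
      (X k (2 * i + 1) * X k (2 * i + 2) - X k (2 * i + 2) * X k (2 * i + 1)) *
        X k (2 * i + 1) ^ (p - 1) * X k (2 * i + 2) ^ (p - 1)).prod

/-- The `T`-space generated by `[x_1, x_2]` and `x_1^p`, plus the `T`-space generated by the
elements `gen k p t` with `t ≥ 1`. -/
def S₁ (k : Type*) [Field k] (p : ℕ) : Submodule k (FreeAlg k) :=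
  tSpan k {X k 0 * X k 1 - X k 1 * X k 0, X k 0 ^ p} ⊔
    tSpan k {f | ∃ t : ℕ, 1 ≤ t ∧ f = gen k p t}

end GrassmannPI

/-!
The proof compares the free algebra with polynomial differential forms. Let `Ω` be the algebra of
polynomial forms, the Grassmann generator `e_i` being `dx_i`, and let `generic` be the homomorphism
from the free algebra to `Ω` with `x_i ↦ x_i + dx_i`. Every homomorphism to the Grassmann algebra
`G` splits the values of the variables into even and odd parts, hence is `generic` followed by
a substitution `Ω → G` (`exists_eval_comp_generic`). So `f` is an identity of `G` exactly when its
generic value lies in the ideal `vanishing` of forms with value zero at all points. As `G` has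
infinitely many generators, one can perturb a point by fresh generators, and this shows that
`vanishing` is stable under `d` and under contraction with `x_i ∂/∂x_i` (`d_mem_vanishing`,
`euler_mem_vanishing`), which takes the place of a normal form modulo the identities.

The generic values are exactly the `w + dw` with `w` an even form (`exists_generic_eq`,
`even_mem_realized`). The centre of `G` is its even part, so `f` has central values exactly when
`dw` is in `vanishing`. The space `S₁` accounts for these closed `w`: commutators have the exact
even forms as generic values (`d_odd_mem_map_generic`), and the substitution instances of
`gen k p t` have the monomial forms whose weights in all variables are zero modulo `p`
(`generic_gen`, `word_mem_map_generic`). By the Cartier isomorphism these two kinds span the closed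
even forms. This is proved with the Lie derivatives `L_i` along `x_i ∂/∂x_i`: they act on monomial
forms by the weight, so `1 - L_i^(p-1)` is the projection to weight zero, while the image of `L_i`
on closed forms is exact by Cartan's formula (`closedEven_le`).
-/

open scoped TensorProduct

namespace GrassmannPI

/-! ### The Grassmann algebra: parity, centre and contractions -/

section Grassmann

variable {k : Type*} [Field k]

/-- The generator `e_i` of the Grassmann algebra. -/
noncomputable def e (k : Type*) [Field k] (i : ℕ) : Grassmann k :=
  ExteriorAlgebra.ι k (Finsupp.single i 1)

/-- The automorphism of the Grassmann algebra with `e_i ↦ -e_i`; its fixed points are the even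
elements. -/
noncomputable def parity (k : Type*) [Field k] : Grassmann k →ₐ[k] Grassmann k :=
  CliffordAlgebra.involute

/-- The contraction of the Grassmann algebra with the coordinate functional dual to `e_i`. -/
noncomputable def contr (k : Type*) [Field k] (i : ℕ) : Grassmann k →ₗ[k] Grassmann k :=
  CliffordAlgebra.contractLeft (Finsupp.lapply i)

theorem e_sq (i : ℕ) : e k i * e k i = 0 := ExteriorAlgebra.ι_sq_zero _

theorem e_mul_e (i j : ℕ) : e k i * e k j = -(e k j * e k i) :=
  eq_neg_of_add_eq_zero_left (ExteriorAlgebra.ι_add_mul_swap _ _)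

@[simp] theorem parity_e (i : ℕ) : parity k (e k i) = -e k i :=
  CliffordAlgebra.involute_ι _

@[simp] theorem parity_parity (z : Grassmann k) : parity k (parity k z) = z :=
  CliffordAlgebra.involute_involute z

@[simp] theorem contr_one (i : ℕ) : contr k i 1 = 0 := CliffordAlgebra.contractLeft_one _ _

theorem contr_e_mul (i j : ℕ) (z : Grassmann k) :
    contr k i (e k j * z) = (if i = j then z else 0) - e k j * contr k i z := by
  have h := CliffordAlgebra.contractLeft_ι_mul (Q := (0 : QuadraticForm k (ℕ →₀ k)))
    (Finsupp.lapply i) (Finsupp.single j 1) z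
  refine h.trans ?_
  by_cases hij : i = j
  · subst hij; simp [contr, e]
  · simp [contr, e, hij]

/-- A subspace that contains `1` and is stable under left multiplication by the generators is the
whole Grassmann algebra. -/
theorem mem_of_e_mul_mem (V : Submodule k (Grassmann k)) (one : (1 : Grassmann k) ∈ V)
    (e_mul : ∀ i, ∀ z ∈ V, e k i * z ∈ V) (z : Grassmann k) : z ∈ V := by
  induction z using CliffordAlgebra.left_induction with
  | algebraMap r => rw [Algebra.algebraMap_eq_smul_one]; exact V.smul_mem _ one
  | add x y hx hy => exact V.add_mem hx hy
  | ι_mul z m hz =>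
    induction m using Finsupp.induction_linear with
    | zero => simp
    | add f g hf hg => rw [map_add, add_mul]; exact V.add_mem hf hg
    | single i c =>
      have : CliffordAlgebra.ι (0 : QuadraticForm k (ℕ →₀ k)) (Finsupp.single i c)
          = c • e k i := by
        rw [e, ExteriorAlgebra.ι, ← map_smul, Finsupp.smul_single, smul_eq_mul, mul_one]
      rw [this, smul_mul_assoc]
      exact V.smul_mem _ (e_mul i z hz)

theorem e_mul_eq_parity_mul (i : ℕ) (z : Grassmann k) : e k i * z = parity k z * e k i := by
  refine mem_of_e_mul_mem (LinearMap.eqLocus (LinearMap.mulLeft k (e k i))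
    (LinearMap.mulRight k (e k i) ∘ₗ (parity k).toLinearMap)) (by simp) ?_ z
  intro j z hz
  simp only [LinearMap.mem_eqLocus, LinearMap.mulLeft_apply, LinearMap.comp_apply,
    AlgHom.toLinearMap_apply, LinearMap.mulRight_apply, map_mul, parity_e] at hz ⊢
  rw [← mul_assoc, e_mul_e i j, neg_mul, mul_assoc, hz, neg_mul, neg_mul, mul_assoc]

theorem odd_mul {y : Grassmann k} (hy : parity k y = -y) (z : Grassmann k) :
    y * z = parity k z * y := by
  refine mem_of_e_mul_mem (LinearMap.eqLocus (LinearMap.mulLeft k y)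
    (LinearMap.mulRight k y ∘ₗ (parity k).toLinearMap)) (by simp) ?_ z
  intro j z hz
  simp only [LinearMap.mem_eqLocus, LinearMap.mulLeft_apply, LinearMap.comp_apply,
    AlgHom.toLinearMap_apply, LinearMap.mulRight_apply, map_mul, parity_e] at hz ⊢
  have h : y * e k j = -(e k j * y) := by rw [e_mul_eq_parity_mul, hy]; simp
  rw [← mul_assoc, h, neg_mul, mul_assoc, hz, neg_mul, neg_mul, mul_assoc]

theorem even_mul {y : Grassmann k} (hy : parity k y = y) (z : Grassmann k) :
    y * z = z * y := by
  refine mem_of_e_mul_mem (LinearMap.eqLocus (LinearMap.mulLeft k y)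
    (LinearMap.mulRight k y)) (by simp) ?_ z
  intro j z hz
  simp only [LinearMap.mem_eqLocus, LinearMap.mulLeft_apply, LinearMap.mulRight_apply] at hz ⊢
  rw [← mul_assoc, ← show e k j * y = y * e k j by rw [e_mul_eq_parity_mul, hy], mul_assoc, hz,
    mul_assoc]

theorem odd_sq (h2 : (2 : k) ≠ 0) {y : Grassmann k} (hy : parity k y = -y) : y * y = 0 := by
  have h : y * y = -(y * y) := by simpa [hy] using odd_mul hy y
  have : (2 : k) • (y * y) = 0 := by rw [two_smul]; exact add_eq_zero_iff_eq_neg.2 h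
  exact (smul_eq_zero.1 this).resolve_left h2

theorem exists_forall_contr_eq_zero (z : Grassmann k) : ∃ N, ∀ u ≥ N, contr k u z = 0 := by
  let V : Submodule k (Grassmann k) :=
    { carrier := {z | ∃ N, ∀ u ≥ N, contr k u z = 0}
      zero_mem' := ⟨0, by simp⟩
      add_mem' := by
        rintro x y ⟨M, hM⟩ ⟨N, hN⟩
        refine ⟨max M N, fun u hu => ?_⟩
        rw [map_add, hM u (le_trans (le_max_left _ _) hu), hN u (le_trans (le_max_right _ _) hu),
          add_zero]
      smul_mem' := by
        rintro c x ⟨M, hM⟩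
        exact ⟨M, fun u hu => by rw [map_smul, hM u hu, smul_zero]⟩ }
  refine mem_of_e_mul_mem V ⟨0, by simp⟩ ?_ z
  rintro i z ⟨N, hN⟩
  refine ⟨max N (i + 1), fun u hu => ?_⟩
  have h1 : u ≠ i := by have := le_trans (le_max_right _ _) hu; omega
  rw [contr_e_mul, if_neg h1, hN u (le_trans (le_max_left _ _) hu)]
  simp

/-- The infinitely many generators have no common annihilator: a generator that does not occur
in `z` can be cancelled from `e_u z = 0`. -/
theorem eq_zero_of_forall_e_mul {z : Grassmann k} (h : ∀ u, e k u * z = 0) : z = 0 := by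
  obtain ⟨N, hN⟩ := exists_forall_contr_eq_zero z
  have := contr_e_mul N N z
  rw [h N, hN N le_rfl] at this
  simpa using this.symm

theorem mem_center_iff (z : Grassmann k) :
    z ∈ Subalgebra.center k (Grassmann k) ↔ parity k z = z := by
  rw [Subalgebra.mem_center_iff]
  refine ⟨fun h => ?_, fun h y => (even_mul h y).symm⟩
  refine sub_eq_zero.1 (eq_zero_of_forall_e_mul fun u => ?_)
  rw [mul_sub, sub_eq_zero, e_mul_eq_parity_mul, parity_parity, h]

end Grassmann

/-! ### Differential forms over the polynomial ring -/

section Forms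

variable {k : Type*} [Field k]

/-- The algebra of polynomial differential forms in countably many variables, with the Grassmann
generator `e_i` in the role of `dx_i`. It is a definition, not an abbreviation, so that its ring
structure is the only source of additive structure that instance search finds. -/
def Forms (k : Type*) [Field k] : Type _ := MvPolynomial ℕ k ⊗[k] Grassmann k

noncomputable instance : Ring (Forms k) :=
  inferInstanceAs (Ring (MvPolynomial ℕ k ⊗[k] Grassmann k))

noncomputable instance : Algebra k (Forms k) :=
  inferInstanceAs (Algebra k (MvPolynomial ℕ k ⊗[k] Grassmann k))

noncomputable instance : Algebra (MvPolynomial ℕ k) (Forms k) :=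
  inferInstanceAs (Algebra (MvPolynomial ℕ k) (MvPolynomial ℕ k ⊗[k] Grassmann k))

instance : IsScalarTower k (MvPolynomial ℕ k) (Forms k) :=
  inferInstanceAs (IsScalarTower k (MvPolynomial ℕ k) (MvPolynomial ℕ k ⊗[k] Grassmann k))

/-- Polynomials as forms of degree zero. -/
noncomputable def poly (k : Type*) [Field k] : MvPolynomial ℕ k →ₐ[k] Forms k :=
  (Algebra.TensorProduct.includeLeft : MvPolynomial ℕ k →ₐ[k] MvPolynomial ℕ k ⊗[k] Grassmann k)

/-- Grassmann elements as forms with constant coefficients. -/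
noncomputable def const (k : Type*) [Field k] : Grassmann k →ₐ[k] Forms k :=
  (Algebra.TensorProduct.includeRight : Grassmann k →ₐ[k] MvPolynomial ℕ k ⊗[k] Grassmann k)

/-- The coordinate function `x_i` as a form of degree zero. -/
noncomputable def x (k : Type*) [Field k] (i : ℕ) : Forms k := poly k (MvPolynomial.X i)

/-- The differential `dx_i` of a coordinate function. -/
noncomputable def dx (k : Type*) [Field k] (i : ℕ) : Forms k := const k (e k i)

/-- The differential of a polynomial. -/
noncomputable def dPoly (k : Type*) [Field k] : Derivation k (MvPolynomial ℕ k) (Forms k) :=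
  MvPolynomial.mkDerivation k (dx k)

/-- The automorphism of the algebra of forms that is `1` on even and `-1` on odd forms. -/
noncomputable def sgn (k : Type*) [Field k] : Forms k →ₐ[k] Forms k :=
  (Algebra.TensorProduct.map (AlgHom.id k _) (parity k) :
    MvPolynomial ℕ k ⊗[k] Grassmann k →ₐ[k] MvPolynomial ℕ k ⊗[k] Grassmann k)

/-- The exterior derivative. -/
noncomputable def d (k : Type*) [Field k] : Forms k →ₗ[k] Forms k :=
  (TensorProduct.lift ((LinearMap.mul k (Forms k)).compl₁₂ (dPoly k).toLinearMap
    (const k).toLinearMap) : MvPolynomial ℕ k ⊗[k] Grassmann k →ₗ[k] Forms k)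

/-- The contraction of forms with the vector field `∂/∂x_i`. -/
noncomputable def contrForm (k : Type*) [Field k] (i : ℕ) : Forms k →ₗ[k] Forms k :=
  (LinearMap.lTensor _ (contr k i) :
    MvPolynomial ℕ k ⊗[k] Grassmann k →ₗ[k] MvPolynomial ℕ k ⊗[k] Grassmann k)

/-- The contraction of forms with the Euler field `x_i ∂/∂x_i` of one variable. -/
noncomputable def euler (k : Type*) [Field k] (i : ℕ) : Forms k →ₗ[k] Forms k :=
  LinearMap.mulLeft k (x k i) ∘ₗ contrForm k i

theorem poly_mul_const (P : MvPolynomial ℕ k) (g : Grassmann k) :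
    poly k P * const k g = (P ⊗ₜ g : MvPolynomial ℕ k ⊗[k] Grassmann k) :=
  (Algebra.TensorProduct.tmul_mul_tmul P 1 1 g).trans (by rw [mul_one, one_mul])

theorem const_mul_poly (P : MvPolynomial ℕ k) (g : Grassmann k) :
    const k g * poly k P = poly k P * const k g :=
  ((Algebra.TensorProduct.tmul_mul_tmul 1 P g 1).trans (by rw [mul_one, one_mul])).trans
    (poly_mul_const P g).symm

theorem forms_induction {C : Forms k → Prop} (zero : C 0) (add : ∀ a b, C a → C b → C (a + b))
    (mul : ∀ P g, C (poly k P * const k g)) (w : Forms k) : C w :=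
  TensorProduct.induction_on (motive := C) w zero
    (fun P g => by rw [← poly_mul_const]; exact mul P g) add

theorem d_poly_mul_const (P : MvPolynomial ℕ k) (g : Grassmann k) :
    d k (poly k P * const k g) = dPoly k P * const k g := by
  rw [poly_mul_const]; rfl

theorem sgn_poly (P : MvPolynomial ℕ k) : sgn k (poly k P) = poly k P :=
  (Algebra.TensorProduct.map_tmul _ _ _ _).trans (by rw [map_one]; rfl)

theorem sgn_const (g : Grassmann k) : sgn k (const k g) = const k (parity k g) :=
  (Algebra.TensorProduct.map_tmul _ _ _ _).trans (by rw [map_one]; rfl)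

theorem contrForm_poly_mul_const (i : ℕ) (P : MvPolynomial ℕ k) (g : Grassmann k) :
    contrForm k i (poly k P * const k g) = poly k P * const k (contr k i g) := by
  rw [poly_mul_const, poly_mul_const]; rfl

theorem poly_smul (P : MvPolynomial ℕ k) (w : Forms k) : P • w = poly k P * w :=
  Algebra.smul_def P w

theorem x_mul_poly_mul (i : ℕ) (P : MvPolynomial ℕ k) (w : Forms k) :
    x k i * (poly k P * w) = poly k (MvPolynomial.X i * P) * w := by
  rw [x, map_mul, mul_assoc]

theorem dx_mul_poly_mul (i : ℕ) (P : MvPolynomial ℕ k) (g : Grassmann k) :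
    dx k i * (poly k P * const k g) = poly k P * const k (e k i * g) := by
  rw [dx, ← mul_assoc, const_mul_poly, map_mul, mul_assoc]

theorem poly_mul_comm (P : MvPolynomial ℕ k) (w : Forms k) :
    poly k P * w = w * poly k P := by
  induction w using forms_induction with
  | zero => simp
  | mul Q g => rw [mul_assoc, const_mul_poly, ← mul_assoc, ← mul_assoc, ← map_mul, ← map_mul,
      mul_comm P]
  | add a b ha hb => rw [mul_add, add_mul, ha, hb]

theorem x_mul_comm (i : ℕ) (w : Forms k) : x k i * w = w * x k i := poly_mul_comm _ w

/-- A subspace that contains `1` and is stable under left multiplication by all `x_i` and `dx_i`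
consists of all forms. -/
theorem mem_of_mul_mem (V : Submodule k (Forms k)) (one : (1 : Forms k) ∈ V)
    (x_mul : ∀ i, ∀ w ∈ V, x k i * w ∈ V) (dx_mul : ∀ i, ∀ w ∈ V, dx k i * w ∈ V)
    (w : Forms k) : w ∈ V := by
  induction w using forms_induction with
  | zero => exact V.zero_mem
  | add a b ha hb => exact V.add_mem ha hb
  | mul P g =>
    revert P
    refine mem_of_e_mul_mem
      { carrier := {g | ∀ P : MvPolynomial ℕ k, poly k P * const k g ∈ V}
        zero_mem' := fun P => by simp
        add_mem' := fun {a b} ha hb P => by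
          rw [map_add, mul_add]; exact V.add_mem (ha P) (hb P)
        smul_mem' := fun c a ha P => by
          rw [map_smul, mul_smul_comm]; exact V.smul_mem c (ha P) } ?_ ?_ g
    · intro P
      induction P using MvPolynomial.induction_on with
      | C a =>
        rw [← mul_one (MvPolynomial.C a), MvPolynomial.C_mul', map_smul, map_one, map_one, mul_one]
        exact V.smul_mem _ one
      | add P Q hP hQ => rw [map_add, add_mul]; exact V.add_mem hP hQ
      | mul_X P i hP => rw [mul_comm, ← x_mul_poly_mul]; exact x_mul i _ hP
    · intro i g hg P
      rw [← dx_mul_poly_mul]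
      exact dx_mul i _ (hg P)

@[simp] theorem sgn_x (i : ℕ) : sgn k (x k i) = x k i := sgn_poly _

@[simp] theorem sgn_dx (i : ℕ) : sgn k (dx k i) = -dx k i := by
  rw [dx, sgn_const, parity_e, map_neg]

theorem dx_sq (i : ℕ) : dx k i * dx k i = 0 := by rw [dx, ← map_mul, e_sq, map_zero]

theorem dx_mul_dx (i j : ℕ) : dx k i * dx k j = -(dx k j * dx k i) := by
  rw [dx, dx, ← map_mul, e_mul_e i j, map_neg, map_mul]

theorem dx_mul_eq_sgn_mul (i : ℕ) (w : Forms k) : dx k i * w = sgn k w * dx k i := by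
  induction w using forms_induction with
  | zero => simp
  | add a b ha hb => rw [mul_add, map_add, add_mul, ha, hb]
  | mul P g => rw [dx_mul_poly_mul, e_mul_eq_parity_mul, map_mul, map_mul, sgn_poly, sgn_const, dx,
      mul_assoc]

theorem odd_form_mul {y : Forms k} (hy : sgn k y = -y) (w : Forms k) : y * w = sgn k w * y := by
  refine mem_of_mul_mem (LinearMap.eqLocus (LinearMap.mulLeft k y)
    (LinearMap.mulRight k y ∘ₗ (sgn k).toLinearMap)) (by simp) ?_ ?_ w <;>
  · intro i w hw
    simp only [LinearMap.mem_eqLocus, LinearMap.mulLeft_apply, LinearMap.comp_apply,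
      AlgHom.toLinearMap_apply, LinearMap.mulRight_apply, map_mul, sgn_x, sgn_dx] at hw ⊢
    first
    | rw [← mul_assoc, ← x_mul_comm, mul_assoc, hw, mul_assoc]
    | have h : y * dx k i = -(dx k i * y) := by rw [dx_mul_eq_sgn_mul, hy]; simp
      rw [← mul_assoc, h, neg_mul, mul_assoc, hw, neg_mul, neg_mul, mul_assoc]

theorem even_form_mul {y : Forms k} (hy : sgn k y = y) (w : Forms k) : y * w = w * y := by
  refine mem_of_mul_mem (LinearMap.eqLocus (LinearMap.mulLeft k y)
    (LinearMap.mulRight k y)) (by simp) ?_ ?_ w <;>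
  · intro i w hw
    simp only [LinearMap.mem_eqLocus, LinearMap.mulLeft_apply, LinearMap.mulRight_apply] at hw ⊢
    first
    | rw [← mul_assoc, ← x_mul_comm, mul_assoc, hw, mul_assoc]
    | have h : y * dx k i = dx k i * y := by rw [dx_mul_eq_sgn_mul, hy]
      rw [← mul_assoc, h, mul_assoc, hw, mul_assoc]

theorem odd_form_sq (h2 : (2 : k) ≠ 0) {y : Forms k} (hy : sgn k y = -y) : y * y = 0 := by
  have h : y * y = -(y * y) := by simpa [hy] using odd_form_mul hy y
  have : (2 : k) • (y * y) = 0 := by rw [two_smul]; exact add_eq_zero_iff_eq_neg.2 h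
  exact (smul_eq_zero.1 this).resolve_left h2

/-! ### The exterior derivative and the contractions -/

@[simp] theorem d_one : d k 1 = 0 := by
  have h := d_poly_mul_const (k := k) 1 1
  rwa [map_one, map_one, mul_one, Derivation.map_one_eq_zero, zero_mul] at h

@[simp] theorem dPoly_X (i : ℕ) : dPoly k (MvPolynomial.X i) = dx k i :=
  MvPolynomial.mkDerivation_X _ _ _

theorem d_x_mul (i : ℕ) (w : Forms k) : d k (x k i * w) = dx k i * w + x k i * d k w := by
  induction w using forms_induction with
  | zero => simp
  | add a b ha hb => rw [mul_add, map_add, ha, hb, map_add]; noncomm_ring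
  | mul P g =>
    rw [x_mul_poly_mul, d_poly_mul_const, d_poly_mul_const, Derivation.leibniz, dPoly_X, poly_smul,
      poly_smul, add_mul, add_comm, ← mul_assoc, ← mul_assoc, poly_mul_comm P (dx k i), x]

theorem dPoly_mul_dx (P : MvPolynomial ℕ k) (i : ℕ) :
    dPoly k P * dx k i
      = -(dx k i * dPoly k P) := by
  induction P using MvPolynomial.induction_on with
  | C a => simp
  | add P Q hP hQ => rw [map_add, add_mul, mul_add, hP, hQ]; abel
  | mul_X P j hP =>
    rw [Derivation.leibniz, dPoly_X, poly_smul, poly_smul, add_mul, mul_add, mul_assoc, mul_assoc,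
      hP, dx_mul_dx j i, ← mul_assoc (dx k i), ← mul_assoc (dx k i), ← poly_mul_comm P,
      ← poly_mul_comm (MvPolynomial.X j)]
    noncomm_ring

theorem d_dx_mul (i : ℕ) (w : Forms k) : d k (dx k i * w) = -(dx k i * d k w) := by
  induction w using forms_induction with
  | zero => simp
  | add a b ha hb => rw [mul_add, map_add, ha, hb, map_add]; noncomm_ring
  | mul P g =>
    rw [dx_mul_poly_mul, d_poly_mul_const, d_poly_mul_const, map_mul, ← dx, ← mul_assoc,
      dPoly_mul_dx, neg_mul, mul_assoc]

theorem d_d (w : Forms k) : d k (d k w) = 0 := by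
  refine mem_of_mul_mem (LinearMap.ker (d k ∘ₗ d k)) (by simp) ?_ ?_ w <;>
  · intro i w hw
    simp only [LinearMap.mem_ker, LinearMap.comp_apply] at hw ⊢
    simp [d_x_mul, d_dx_mul, hw]

theorem sgn_d (w : Forms k) : sgn k (d k w) = -d k (sgn k w) := by
  refine mem_of_mul_mem (LinearMap.eqLocus ((sgn k).toLinearMap ∘ₗ d k)
    (-(d k ∘ₗ (sgn k).toLinearMap))) (by simp) ?_ ?_ w <;>
  · intro i w hw
    simp only [LinearMap.mem_eqLocus, LinearMap.comp_apply, AlgHom.toLinearMap_apply,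
      LinearMap.neg_apply] at hw ⊢
    simp [d_x_mul, d_dx_mul, hw]
    try abel

theorem d_mul (v w : Forms k) : d k (v * w) = d k v * w + sgn k v * d k w := by
  refine mem_of_mul_mem (LinearMap.eqLocus (d k ∘ₗ LinearMap.mulRight k w)
    (LinearMap.mulRight k w ∘ₗ d k + LinearMap.mulRight k (d k w) ∘ₗ (sgn k).toLinearMap))
    (by simp) ?_ ?_ v <;>
  · intro i v hv
    simp only [LinearMap.mem_eqLocus, LinearMap.comp_apply, AlgHom.toLinearMap_apply,
      LinearMap.add_apply, LinearMap.mulRight_apply] at hv ⊢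
    rw [mul_assoc]
    simp only [d_x_mul, d_dx_mul, hv, map_mul, sgn_x, sgn_dx]
    noncomm_ring

@[simp] theorem euler_one (i : ℕ) : euler k i 1 = 0 := by
  have h := contrForm_poly_mul_const (k := k) i 1 1
  rw [map_one, map_one, mul_one, contr_one, map_zero, mul_zero] at h
  rw [euler, LinearMap.comp_apply, h, map_zero]

theorem euler_x_mul (i j : ℕ) (w : Forms k) : euler k i (x k j * w) = x k j * euler k i w := by
  induction w using forms_induction with
  | zero => simp
  | add a b ha hb => rw [mul_add, map_add, ha, hb, map_add, mul_add]
  | mul P g =>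
    simp only [euler, LinearMap.comp_apply, LinearMap.mulLeft_apply, x_mul_poly_mul,
      contrForm_poly_mul_const, mul_left_comm]

theorem euler_dx_mul (i j : ℕ) (w : Forms k) :
    euler k i (dx k j * w) = (if i = j then x k i * w else 0) - dx k j * euler k i w := by
  induction w using forms_induction with
  | zero => simp
  | add a b ha hb =>
    rw [mul_add, map_add, ha, hb, map_add, mul_add, mul_add]
    split_ifs <;> abel
  | mul P g =>
    simp only [euler, LinearMap.comp_apply, LinearMap.mulLeft_apply, dx_mul_poly_mul,
      contrForm_poly_mul_const, contr_e_mul, x_mul_poly_mul]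
    split_ifs <;> simp [mul_sub]

theorem sgn_euler (i : ℕ) (w : Forms k) : sgn k (euler k i w) = -euler k i (sgn k w) := by
  refine mem_of_mul_mem (LinearMap.eqLocus ((sgn k).toLinearMap ∘ₗ euler k i)
    (-(euler k i ∘ₗ (sgn k).toLinearMap))) (by simp) ?_ ?_ w <;>
  · intro j w hw
    simp only [LinearMap.mem_eqLocus, LinearMap.comp_apply, AlgHom.toLinearMap_apply,
      LinearMap.neg_apply] at hw ⊢
    simp only [map_mul, sgn_x, sgn_dx, neg_mul, map_neg, euler_x_mul, euler_dx_mul, map_sub, hw]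
    first | (split_ifs <;> simp) | rw [mul_neg]

/-- The Lie derivative along `x_i ∂/∂x_i`, by Cartan's formula; it multiplies a monomial form by
the number of times that `x_i` and `dx_i` occur in it. -/
noncomputable def lie (k : Type*) [Field k] (i : ℕ) : Forms k →ₗ[k] Forms k :=
  d k ∘ₗ euler k i + euler k i ∘ₗ d k

theorem lie_apply (i : ℕ) (w : Forms k) :
    lie k i w = d k (euler k i w) + euler k i (d k w) := rfl

@[simp] theorem lie_one (i : ℕ) : lie k i 1 = 0 := by simp [lie_apply]

theorem lie_x_mul (i j : ℕ) (w : Forms k) :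
    lie k i (x k j * w) = x k j * lie k i w + if i = j then x k j * w else 0 := by
  simp only [lie_apply, euler_x_mul, d_x_mul, map_add, euler_dx_mul]
  split_ifs with h
  · subst h; noncomm_ring
  · noncomm_ring

theorem lie_dx_mul (i j : ℕ) (w : Forms k) :
    lie k i (dx k j * w) = dx k j * lie k i w + if i = j then dx k j * w else 0 := by
  simp only [lie_apply, euler_dx_mul, d_dx_mul, map_sub, map_neg]
  split_ifs with h
  · subst h; rw [d_x_mul]; noncomm_ring
  · simp; noncomm_ring

theorem sgn_lie (i : ℕ) (w : Forms k) : sgn k (lie k i w) = lie k i (sgn k w) := by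
  simp [lie_apply, sgn_d, sgn_euler]

theorem d_lie (i : ℕ) (w : Forms k) : d k (lie k i w) = d k (euler k i (d k w)) := by
  simp [lie_apply, d_d]

end Forms

section Eval

variable {k : Type*} [Field k]

/-! ### The generic homomorphism to the forms -/

/-- The generic homomorphism from the free algebra, with `x_i ↦ x_i + dx_i`. -/
noncomputable def generic (k : Type*) [Field k] : FreeAlg k →ₐ[k] Forms k :=
  FreeAlgebra.lift k fun i => x k i + dx k i

@[simp] theorem generic_X (i : ℕ) : generic k (X k i) = x k i + dx k i :=
  FreeAlgebra.lift_ι_apply _ _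

/-- The value of the generic homomorphism is determined by its even part `w`; the odd part is
`dw`. -/
theorem exists_generic_eq (f : FreeAlg k) : ∃ w, sgn k w = w ∧ generic k f = w + d k w := by
  induction f using FreeAlgebra.induction with
  | grade0 r =>
    refine ⟨algebraMap k _ r, AlgHom.commutes _ _, ?_⟩
    rw [AlgHom.commutes, Algebra.algebraMap_eq_smul_one, map_smul, d_one, smul_zero, add_zero]
  | grade1 i =>
    have h : d k (x k i) = dx k i := by simpa using d_x_mul i (1 : Forms k)
    exact ⟨x k i, sgn_x i, by rw [h]; exact generic_X i⟩
  | add a b ha hb =>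
    obtain ⟨v, hv, ha⟩ := ha
    obtain ⟨w, hw, hb⟩ := hb
    exact ⟨v + w, by rw [map_add, hv, hw], by rw [map_add, map_add, ha, hb]; abel⟩
  | mul a b ha hb =>
    obtain ⟨v, hv, ha⟩ := ha
    obtain ⟨w, hw, hb⟩ := hb
    refine ⟨v * w + d k v * d k w, ?_, ?_⟩
    · simp [sgn_d, hv, hw]
    · rw [map_mul, ha, hb, map_add, d_mul, d_mul, d_d, d_d, hv]
      noncomm_ring

theorem sgn_d_of_even {w : Forms k} (hw : sgn k w = w) : sgn k (d k w) = -d k w := by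
  rw [sgn_d, hw]

/-! ### Values of forms in the Grassmann algebra -/

/-- Values for all `x_i` and `dx_i` in the Grassmann algebra: even ones for the `x_i` and odd ones
for the `dx_i`. -/
structure Point (k : Type*) [Field k] where
  /-- The values of the `x_i`. -/
  even : ℕ → Grassmann k
  /-- The values of the `dx_i`. -/
  odd : ℕ → Grassmann k
  parity_even : ∀ i, parity k (even i) = even i
  parity_odd : ∀ i, parity k (odd i) = -odd i

namespace Point

theorem parity_linearCombination (q : Point k) (m : ℕ →₀ k) :
    parity k (Finsupp.linearCombination k q.odd m) = -Finsupp.linearCombination k q.odd m := by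
  induction m using Finsupp.induction_linear with
  | zero => simp
  | add f g hf hg => rw [map_add, map_add, hf, hg, neg_add]
  | single i c => simp [q.parity_odd]

/-- Substitution of even values for the variables of a polynomial. The values lie in the centre of
the Grassmann algebra, which is where the substitution takes place. -/
noncomputable def evenHom (q : Point k) : MvPolynomial ℕ k →ₐ[k] Grassmann k :=
  (Subalgebra.center k (Grassmann k)).val.comp
    (MvPolynomial.aeval fun i => ⟨q.even i, (mem_center_iff _).2 (q.parity_even i)⟩)

theorem even_mul_comm (q : Point k) (i : ℕ) (z : Grassmann k) : q.even i * z = z * q.even i :=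
  even_mul (q.parity_even i) z

variable [NeZero (2 : k)]

/-- Substitution of odd values for the generators of the Grassmann algebra. -/
noncomputable def oddHom (q : Point k) : Grassmann k →ₐ[k] Grassmann k :=
  ExteriorAlgebra.lift k ⟨Finsupp.linearCombination k q.odd,
    fun m => odd_sq two_ne_zero (q.parity_linearCombination m)⟩

theorem commute_evenHom_oddHom (q : Point k) (P : MvPolynomial ℕ k) (g : Grassmann k) :
    Commute (q.evenHom P) (q.oddHom g) :=
  (Subalgebra.mem_center_iff.1 (Subtype.prop _) (q.oddHom g)).symm

/-- The value of a form. -/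
noncomputable def eval (q : Point k) : Forms k →ₐ[k] Grassmann k :=
  Algebra.TensorProduct.lift q.evenHom q.oddHom q.commute_evenHom_oddHom

@[simp] theorem eval_x (q : Point k) (i : ℕ) : q.eval (x k i) = q.even i := by
  refine (Algebra.TensorProduct.lift_tmul _ _ _ _ _).trans ?_
  simp [evenHom]

@[simp] theorem eval_dx (q : Point k) (i : ℕ) : q.eval (dx k i) = q.odd i := by
  refine (Algebra.TensorProduct.lift_tmul _ _ _ _ _).trans ?_
  simp [oddHom, e]

theorem parity_eval (q : Point k) (w : Forms k) : parity k (q.eval w) = q.eval (sgn k w) := by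
  refine mem_of_mul_mem (LinearMap.eqLocus ((parity k).comp q.eval).toLinearMap
    (q.eval.comp (sgn k)).toLinearMap) (by simp) ?_ ?_ w <;>
  · intro i w hw
    simp only [LinearMap.mem_eqLocus, AlgHom.toLinearMap_apply, AlgHom.comp_apply] at hw ⊢
    simp [hw, q.parity_even, q.parity_odd]

/-- The point `(x_i + e_u dx_i, dx_i)`, at which a form `w` has the value of `w + e_u dw` at the
original point. -/
noncomputable def shiftEven (q : Point k) (u : ℕ) : Point k where
  even i := q.even i + e k u * q.odd i
  odd := q.odd
  parity_even i := by simp [q.parity_even, q.parity_odd]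
  parity_odd := q.parity_odd

theorem eval_shiftEven (q : Point k) (u : ℕ) (w : Forms k) :
    (q.shiftEven u).eval w = q.eval w + e k u * q.eval (d k w) := by
  refine mem_of_mul_mem (LinearMap.eqLocus (q.shiftEven u).eval.toLinearMap
    (q.eval.toLinearMap + LinearMap.mulLeft k (e k u) ∘ₗ q.eval.toLinearMap ∘ₗ d k))
    (by simp) ?_ ?_ w
  all_goals
    intro i w hw
    have hu : q.odd i * e k u = -(e k u * q.odd i) := by
      rw [e_mul_eq_parity_mul, q.parity_odd, neg_mul, neg_neg]
    simp only [LinearMap.mem_eqLocus, AlgHom.toLinearMap_apply, LinearMap.add_apply,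
      LinearMap.comp_apply, LinearMap.mulLeft_apply, map_mul, map_add, map_neg, eval_x, eval_dx,
      d_x_mul, d_dx_mul] at hw ⊢
    rw [hw]
    simp only [shiftEven, mul_add, add_mul]
  · have h1 : q.even i * (e k u * q.eval (d k w)) = e k u * (q.even i * q.eval (d k w)) := by
      rw [← mul_assoc, q.even_mul_comm, mul_assoc]
    have h2 : e k u * q.odd i * (e k u * q.eval (d k w)) = 0 := by
      rw [mul_assoc, ← mul_assoc (q.odd i), hu, neg_mul, mul_neg, mul_assoc, ← mul_assoc, e_sq,
        zero_mul, neg_zero]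
    rw [h1, h2, mul_assoc]
    abel
  · rw [← mul_assoc, hu, neg_mul, mul_assoc]

/-- The point at which `dx_i` is increased by `x_i e_u`; there a form has the value of
`w + e_u (x_i ∂/∂x_i ⌋ w)` at the original point. -/
noncomputable def shiftOdd (q : Point k) (i u : ℕ) : Point k where
  even := q.even
  odd j := q.odd j + if i = j then e k u * q.even i else 0
  parity_even := q.parity_even
  parity_odd j := by split_ifs <;> simp [q.parity_odd, q.parity_even, add_comm]

theorem eval_shiftOdd (q : Point k) (i u : ℕ) (w : Forms k) :
    (q.shiftOdd i u).eval w = q.eval w + e k u * q.eval (euler k i w) := by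
  refine mem_of_mul_mem (LinearMap.eqLocus (q.shiftOdd i u).eval.toLinearMap
    (q.eval.toLinearMap + LinearMap.mulLeft k (e k u) ∘ₗ q.eval.toLinearMap ∘ₗ euler k i))
    (by simp) ?_ ?_ w
  all_goals
    intro j w hw
    simp only [LinearMap.mem_eqLocus, AlgHom.toLinearMap_apply, LinearMap.add_apply,
      LinearMap.comp_apply, LinearMap.mulLeft_apply, map_mul, map_sub, eval_x, eval_dx,
      euler_x_mul, euler_dx_mul] at hw ⊢
    rw [hw]
    simp only [shiftOdd, mul_add, add_mul]
  · rw [← mul_assoc (q.even j) (e k u), q.even_mul_comm j (e k u), mul_assoc]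
  · have hu : q.odd j * (e k u * q.eval (euler k i w))
        = -(e k u * (q.odd j * q.eval (euler k i w))) := by
      rw [← mul_assoc, ← mul_assoc, e_mul_eq_parity_mul, q.parity_odd, neg_mul, neg_mul, neg_neg]
    rw [hu]
    split_ifs with hij
    · have h2 : e k u * q.even i * (e k u * q.eval (euler k i w)) = 0 := by
        rw [mul_assoc, q.even_mul_comm, ← mul_assoc, ← mul_assoc, e_sq, zero_mul, zero_mul]
      rw [h2, map_mul, eval_x, mul_assoc]
      abel
    · rw [map_zero, mul_zero, zero_mul, zero_mul]
      abel

end Point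

variable [NeZero (2 : k)]

/-- The forms that vanish at all points. -/
noncomputable def vanishing (k : Type*) [Field k] [NeZero (2 : k)] : Submodule k (Forms k) :=
  ⨅ q : Point k, LinearMap.ker q.eval.toLinearMap

theorem mem_vanishing {w : Forms k} : w ∈ vanishing k ↔ ∀ q : Point k, q.eval w = 0 := by
  simp [vanishing]

theorem d_mem_vanishing {w : Forms k} (hw : w ∈ vanishing k) : d k w ∈ vanishing k := by
  rw [mem_vanishing] at hw ⊢
  refine fun q => eq_zero_of_forall_e_mul fun u => ?_
  have := q.eval_shiftEven u w
  rw [hw, hw, zero_add] at this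
  exact this.symm

theorem euler_mem_vanishing (i : ℕ) {w : Forms k} (hw : w ∈ vanishing k) :
    euler k i w ∈ vanishing k := by
  rw [mem_vanishing] at hw ⊢
  refine fun q => eq_zero_of_forall_e_mul fun u => ?_
  have := q.eval_shiftOdd i u w
  rw [hw, hw, zero_add] at this
  exact this.symm

/-- Every homomorphism to the Grassmann algebra is a specialization of the generic one: split the
values of the variables into even and odd parts. -/
theorem exists_eval_comp_generic (φ : FreeAlg k →ₐ[k] Grassmann k) :
    ∃ q : Point k, φ = q.eval.comp (generic k) := by
  refine ⟨{ even := fun i => (2⁻¹ : k) • (φ (X k i) + parity k (φ (X k i)))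
            odd := fun i => (2⁻¹ : k) • (φ (X k i) - parity k (φ (X k i)))
            parity_even := fun i => by simp [add_comm]
            parity_odd := fun i => by rw [map_smul, map_sub, parity_parity, ← smul_neg, neg_sub] },
    ?_⟩
  refine FreeAlgebra.hom_ext (funext fun i => ?_)
  have h : generic k (FreeAlgebra.ι k i) = x k i + dx k i := generic_X i
  simp only [Function.comp_apply, AlgHom.comp_apply, h, map_add, Point.eval_x, Point.eval_dx]
  rw [← smul_add, add_add_sub_cancel, ← two_smul k, smul_smul, inv_mul_cancel₀ two_ne_zero,
    one_smul, X]

theorem mem_identities_iff {f : FreeAlg k} :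
    f ∈ identities k (Grassmann k) ↔ generic k f ∈ vanishing k := by
  rw [mem_vanishing]
  simp only [identities, Submodule.mem_iInf, LinearMap.mem_ker, AlgHom.toLinearMap_apply]
  refine ⟨fun h q => h (q.eval.comp (generic k)), fun h φ => ?_⟩
  obtain ⟨q, rfl⟩ := exists_eval_comp_generic φ
  exact h q

theorem forall_mem_center_iff {f : FreeAlg k} :
    (∀ φ : FreeAlg k →ₐ[k] Grassmann k, φ f ∈ Subalgebra.center k (Grassmann k)) ↔
      sgn k (generic k f) - generic k f ∈ vanishing k := by
  simp only [mem_vanishing, mem_center_iff, map_sub, sub_eq_zero, ← Point.parity_eval]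
  refine ⟨fun h q => h (q.eval.comp (generic k)), fun h φ => ?_⟩
  obtain ⟨q, rfl⟩ := exists_eval_comp_generic φ
  exact h q

end Eval

/-! ### Monomial forms -/

section Words

variable {k : Type*} [Field k]

/-- The monomial form `x^a dx_{i_1} ⋯ dx_{i_r}`, where `L = [i_1, …, i_r]` may be unsorted and may
have repetitions. -/
noncomputable def word (k : Type*) [Field k] (a : ℕ →₀ ℕ) (L : List ℕ) : Forms k :=
  poly k (MvPolynomial.monomial a 1) * (L.map (dx k)).prod

theorem word_zero_nil : word k 0 [] = 1 := by
  simp [word, ← MvPolynomial.C_apply]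

theorem word_mul_word (a b : ℕ →₀ ℕ) (L M : List ℕ) :
    word k a L * word k b M = word k (a + b) (L ++ M) := by
  have h : poly k (MvPolynomial.monomial (a + b) 1)
      = poly k (MvPolynomial.monomial a 1) * poly k (MvPolynomial.monomial b 1) := by
    rw [← map_mul, MvPolynomial.monomial_mul, one_mul]
  rw [word, word, word, List.map_append, List.prod_append, h, mul_assoc, mul_assoc,
    ← mul_assoc _ (poly k _), ← poly_mul_comm, mul_assoc]

theorem x_pow (i n : ℕ) : x k i ^ n = word k (Finsupp.single i n) [] := by
  simp [word, x, ← map_pow, MvPolynomial.X_pow_eq_monomial]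

theorem x_mul_word (i : ℕ) (a : ℕ →₀ ℕ) (L : List ℕ) :
    x k i * word k a L = word k (Finsupp.single i 1 + a) L := by
  rw [← pow_one (x k i), x_pow, word_mul_word, List.nil_append]

theorem dx_mul_word (i : ℕ) (a : ℕ →₀ ℕ) (L : List ℕ) :
    dx k i * word k a L = word k a (i :: L) := by
  rw [word, ← mul_assoc, ← poly_mul_comm, mul_assoc, word, List.map_cons, List.prod_cons]

theorem sgn_word (a : ℕ →₀ ℕ) (L : List ℕ) : sgn k (word k a L) = (-1) ^ L.length * word k a L := by
  induction L with
  | nil => simp [word, sgn_poly]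
  | cons i L ih =>
    rw [← dx_mul_word, map_mul, ih, sgn_dx, List.length_cons, pow_succ, ← mul_assoc, neg_mul,
      ← ((Commute.neg_one_left (dx k i)).pow_left _).eq]
    simp [mul_assoc]

theorem lie_word (i : ℕ) (a : ℕ →₀ ℕ) (L : List ℕ) :
    lie k i (word k a L) = ((a i + L.count i : ℕ) : k) • word k a L := by
  induction L with
  | nil =>
    induction a using Finsupp.induction with
    | zero => simp [word_zero_nil]
    | single_add j n b _ _ hb =>
      clear * - hb
      induction n with
      | zero => simpa using hb
      | succ n ih =>
        rw [add_comm n 1, Finsupp.single_add, add_assoc, ← x_mul_word, lie_x_mul, ih,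
          Finsupp.add_apply (Finsupp.single j 1), add_assoc, Nat.cast_add _ (_ + _), add_smul,
          mul_smul_comm, add_comm]
        congr 1
        by_cases hij : i = j
        · subst hij; simp
        · simp [hij]
  | cons j L ih =>
    rw [← dx_mul_word, lie_dx_mul, ih, mul_smul_comm]
    by_cases hij : i = j
    · subst hij
      rw [if_pos rfl, List.count_cons_self, ← add_assoc, Nat.cast_add _ 1, add_smul, Nat.cast_one,
        one_smul]
    · rw [if_neg hij, List.count_cons_of_ne (Ne.symm hij), add_zero]

theorem dx_mul_prod_eq_zero {i : ℕ} {L : List ℕ} (h : i ∈ L) :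
    dx k i * (L.map (dx k)).prod = 0 := by
  induction L with
  | nil => simp at h
  | cons j L ih =>
    rw [List.map_cons, List.prod_cons, ← mul_assoc]
    rcases List.mem_cons.1 h with rfl | h
    · rw [dx_sq, zero_mul]
    · rw [dx_mul_dx, neg_mul, mul_assoc, ih h, mul_zero, neg_zero]

theorem word_eq_zero {L : List ℕ} (h : ¬ L.Nodup) (a : ℕ →₀ ℕ) : word k a L = 0 := by
  have : (L.map (dx k)).prod = 0 := by
    induction L with
    | nil => simp at h
    | cons i L ih =>
      by_cases hi : i ∈ L
      · exact dx_mul_prod_eq_zero hi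
      · rw [List.map_cons, List.prod_cons, ih (fun hL => h (List.nodup_cons.2 ⟨hi, hL⟩)), mul_zero]
  rw [word, this, mul_zero]

theorem mem_span_words (w : Forms k) :
    w ∈ Submodule.span k (Set.range fun q : (ℕ →₀ ℕ) × List ℕ => word k q.1 q.2) := by
  refine mem_of_mul_mem
    (Submodule.span k (Set.range fun q : (ℕ →₀ ℕ) × List ℕ => word k q.1 q.2))
    (Submodule.subset_span ⟨(0, []), word_zero_nil⟩) ?_ ?_ w
  · intro i w hw
    induction hw using Submodule.span_induction with
    | mem w hw =>
      obtain ⟨⟨a, L⟩, rfl⟩ := hw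
      exact Submodule.subset_span ⟨(Finsupp.single i 1 + a, L), (x_mul_word i a L).symm⟩
    | zero => simp
    | add v w _ _ hv hw => rw [mul_add]; exact add_mem hv hw
    | smul c w _ hw => rw [mul_smul_comm]; exact Submodule.smul_mem _ _ hw
  · intro i w hw
    induction hw using Submodule.span_induction with
    | mem w hw =>
      obtain ⟨⟨a, L⟩, rfl⟩ := hw
      exact Submodule.subset_span ⟨(a, i :: L), (dx_mul_word i a L).symm⟩
    | zero => simp
    | add v w _ _ hv hw => rw [mul_add]; exact add_mem hv hw
    | smul c w _ hw => rw [mul_smul_comm]; exact Submodule.smul_mem _ _ hw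

theorem mem_span_even_words [NeZero (2 : k)] {w : Forms k} (hw : sgn k w = w) :
    w ∈ Submodule.span k {v | ∃ a L, Even L.length ∧ v = word k a L} := by
  have key : ∀ w : Forms k,
      w + sgn k w ∈ Submodule.span k {v | ∃ a L, Even L.length ∧ v = word k a L} := by
    intro w
    induction mem_span_words w using Submodule.span_induction with
    | mem w hw =>
      obtain ⟨⟨a, L⟩, rfl⟩ := hw
      rcases Nat.even_or_odd L.length with h | h
      · rw [sgn_word, h.neg_one_pow, one_mul]
        exact add_mem (Submodule.subset_span ⟨a, L, h, rfl⟩) (Submodule.subset_span ⟨a, L, h, rfl⟩)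
      · rw [sgn_word, h.neg_one_pow, neg_one_mul, add_neg_cancel]; exact zero_mem _
    | zero => simp
    | add v w _ _ hv hw => rw [map_add, add_add_add_comm]; exact add_mem hv hw
    | smul c w _ hw => rw [map_smul, ← smul_add]; exact Submodule.smul_mem _ _ hw
  have h : w = (2⁻¹ : k) • (w + sgn k w) := by
    rw [hw, ← two_smul k, smul_smul, inv_mul_cancel₀ two_ne_zero, one_smul]
  rw [h]
  exact Submodule.smul_mem _ _ (key w)

theorem mem_span_odd_words [NeZero (2 : k)] {w : Forms k} (hw : sgn k w = -w) :
    w ∈ Submodule.span k {v | ∃ j a L, Even L.length ∧ v = dx k j * word k a L} := by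
  have key : ∀ w : Forms k,
      w - sgn k w ∈ Submodule.span k {v | ∃ j a L, Even L.length ∧ v = dx k j * word k a L} := by
    intro w
    induction mem_span_words w using Submodule.span_induction with
    | mem w hw =>
      obtain ⟨⟨a, L⟩, rfl⟩ := hw
      rcases Nat.even_or_odd L.length with h | h
      · rw [sgn_word, h.neg_one_pow, one_mul, sub_self]; exact zero_mem _
      · rw [sgn_word, h.neg_one_pow, neg_one_mul, sub_neg_eq_add]
        cases L with
        | nil => simp at h
        | cons j L =>
          have : Even L.length := by rw [List.length_cons] at h; grind
          exact add_mem (Submodule.subset_span ⟨j, a, L, this, (dx_mul_word _ _ _).symm⟩)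
            (Submodule.subset_span ⟨j, a, L, this, (dx_mul_word _ _ _).symm⟩)
    | zero => simp
    | add v w _ _ hv hw => rw [map_add, add_sub_add_comm]; exact add_mem hv hw
    | smul c w _ hw => rw [map_smul, ← smul_sub]; exact Submodule.smul_mem _ _ hw
  have h : w = (2⁻¹ : k) • (w - sgn k w) := by
    rw [hw, sub_neg_eq_add, ← two_smul k, smul_smul, inv_mul_cancel₀ two_ne_zero, one_smul]
  rw [h]
  exact Submodule.smul_mem _ _ (key w)

/-- Induction for even forms: they are generated from `1` by multiplications with the `x_i` and the
products `dx_i dx_j`. -/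
theorem mem_of_even [NeZero (2 : k)] (V : Submodule k (Forms k)) (one : (1 : Forms k) ∈ V)
    (x_mul : ∀ i, ∀ w ∈ V, x k i * w ∈ V)
    (dx_mul : ∀ i j, ∀ w ∈ V, dx k i * (dx k j * w) ∈ V) {w : Forms k} (hw : sgn k w = w) :
    w ∈ V := by
  refine Submodule.span_le.2 ?_ (mem_span_even_words hw)
  rintro _ ⟨a, L, hL, rfl⟩
  have hprod : ∀ (n : ℕ) (L : List ℕ), L.length = 2 * n → (L.map (dx k)).prod ∈ V := by
    intro n
    induction n with
    | zero => 
      intro L hL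
      obtain rfl : L = [] := List.length_eq_zero_iff.1 hL
      exact one
    | succ n ih =>
      intro L hL
      match L, hL with
      | i :: j :: L, hL =>
        simp only [List.map_cons, List.prod_cons]
        exact dx_mul i j _ (ih L (by simp only [List.length_cons] at hL; omega))
  obtain ⟨n, hn⟩ := hL
  have hV := hprod n L (by omega)
  have hpoly : ∀ P : MvPolynomial ℕ k, ∀ w ∈ V, poly k P * w ∈ V := by
    intro P
    induction P using MvPolynomial.induction_on with
    | C c =>
      intro w hw
      rw [← mul_one (MvPolynomial.C c), MvPolynomial.C_mul', map_smul, map_one, smul_mul_assoc,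
        one_mul]
      exact V.smul_mem _ hw
    | add P Q hP hQ => intro w hw; rw [map_add, add_mul]; exact V.add_mem (hP w hw) (hQ w hw)
    | mul_X P i hP => intro w hw; rw [map_mul, mul_assoc]; exact hP _ (x_mul i w hw)
  exact hpoly _ _ hV

/-! ### Even forms and exact forms as generic values -/

/-- The forms `w` such that `w + dw` is a value of the generic homomorphism. -/
noncomputable def realized (k : Type*) [Field k] : Submodule k (Forms k) :=
  (LinearMap.range (generic k).toLinearMap).comap (LinearMap.id + d k)

theorem mem_realized {w : Forms k} : w ∈ realized k ↔ ∃ f, generic k f = w + d k w := Iff.rfl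

theorem generic_commutator (i j : ℕ) :
    generic k (X k i * X k j - X k j * X k i) = (2 : k) • (dx k i * dx k j) := by
  rw [map_sub, map_mul, map_mul, generic_X, generic_X, two_smul, add_mul, add_mul, mul_add,
    mul_add, mul_add, mul_add, x_mul_comm i (x k j), x_mul_comm i (dx k j),
    x_mul_comm j (dx k i), dx_mul_dx j i]
  abel

theorem dx_mul_dx_mul_mem_realized [NeZero (2 : k)] (i j : ℕ) {w : Forms k}
    (hw : w ∈ realized k) : dx k i * (dx k j * w) ∈ realized k := by
  obtain ⟨f, hf⟩ := mem_realized.1 hw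
  refine mem_realized.2 ⟨(2⁻¹ : k) • ((X k i * X k j - X k j * X k i) * f), ?_⟩
  rw [map_smul, map_mul, generic_commutator, hf, smul_mul_assoc, smul_smul,
    inv_mul_cancel₀ two_ne_zero, one_smul, d_dx_mul, d_dx_mul]
  noncomm_ring

theorem x_mul_mem_realized (i : ℕ) {w : Forms k} (hw : w ∈ realized k)
    (hdw : dx k i * d k w ∈ realized k) : x k i * w ∈ realized k := by
  obtain ⟨f, hf⟩ := mem_realized.1 hw
  obtain ⟨g, hg⟩ := mem_realized.1 hdw
  refine mem_realized.2 ⟨X k i * f - g, ?_⟩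
  rw [map_sub, map_mul, hf, hg, generic_X, d_x_mul, d_dx_mul, d_d]
  noncomm_ring

/-- Every even form is the even part of a value of the generic homomorphism. The induction also
realizes all `dx_i dw`, as these are the corrections to `x_i ↦ x_i + dx_i` being multiplicative on
even parts. -/
theorem even_mem_realized [NeZero (2 : k)] {w : Forms k} (hw : sgn k w = w) :
    w ∈ realized k := by
  have h := mem_of_even (k := k) (w := w)
    (realized k ⊓ ⨅ i, (realized k).comap (LinearMap.mulLeft k (dx k i) ∘ₗ d k)) ?_ ?_ ?_ hw
  · exact h.1
  · refine ⟨mem_realized.2 ⟨1, by simp⟩, ?_⟩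
    simp
  · intro i w hw
    simp only [Submodule.mem_inf, Submodule.mem_iInf, Submodule.mem_comap, LinearMap.comp_apply,
      LinearMap.mulLeft_apply] at hw ⊢
    refine ⟨x_mul_mem_realized i hw.1 (hw.2 i), fun j => ?_⟩
    have h1 : dx k j * d k (x k i * w) = dx k j * (dx k i * w) + x k i * (dx k j * d k w) := by
      rw [d_x_mul, mul_add, ← mul_assoc _ (x k i), ← x_mul_comm, mul_assoc]
    rw [h1]
    refine add_mem (dx_mul_dx_mul_mem_realized j i hw.1) (x_mul_mem_realized i (hw.2 j) ?_)
    rw [d_dx_mul, d_d, mul_zero, neg_zero, mul_zero]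
    exact zero_mem _
  · intro i j w hw
    simp only [Submodule.mem_inf, Submodule.mem_iInf, Submodule.mem_comap, LinearMap.comp_apply,
      LinearMap.mulLeft_apply] at hw ⊢
    refine ⟨dx_mul_dx_mul_mem_realized i j hw.1, fun l => ?_⟩
    have h1 : dx k l * d k (dx k i * (dx k j * w)) = dx k i * (dx k j * (dx k l * d k w)) := by
      rw [d_dx_mul, d_dx_mul, mul_neg, mul_neg, mul_neg, neg_neg, ← mul_assoc, dx_mul_dx l i,
        neg_mul, mul_assoc,
        ← mul_assoc (dx k l), dx_mul_dx l j, neg_mul, mul_neg, neg_neg, mul_assoc]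
    rw [h1]
    exact dx_mul_dx_mul_mem_realized i j (hw.2 l)

/-- The derivative of an odd form is the generic value of a linear combination of commutators. -/
theorem d_odd_mem_map_generic [NeZero (2 : k)] (V : Submodule k (FreeAlg k))
    (hV : ∀ f g, f * g - g * f ∈ V) {w : Forms k} (hw : sgn k w = -w) :
    d k w ∈ V.map (generic k).toLinearMap := by
  have key : Submodule.span k {v | ∃ j a L, Even L.length ∧ v = dx k j * word k a L} ≤
      (V.map (generic k).toLinearMap).comap (d k) := by
    refine Submodule.span_le.2 ?_
    rintro _ ⟨j, a, L, hL, rfl⟩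
    have heven : sgn k (word k a L) = word k a L := by rw [sgn_word, hL.neg_one_pow, one_mul]
    obtain ⟨f, hf⟩ := mem_realized.1 (even_mem_realized heven)
    refine ⟨(-2⁻¹ : k) • (X k j * f - f * X k j), V.smul_mem _ (hV _ _), ?_⟩
    have h1 : d k (word k a L) * dx k j = -(dx k j * d k (word k a L)) := by
      rw [dx_mul_eq_sgn_mul, sgn_d_of_even heven, neg_mul, neg_neg]
    have h2 : generic k (X k j * f - f * X k j) = (2 : k) • (dx k j * d k (word k a L)) := by
      rw [map_sub, map_mul, map_mul, generic_X, hf, two_smul, add_mul, add_mul, mul_add, mul_add,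
        mul_add, mul_add, h1, even_form_mul heven (dx k j), x_mul_comm j, x_mul_comm j]
      abel
    rw [AlgHom.toLinearMap_apply, map_smul, h2, smul_smul, d_dx_mul, neg_mul,
      inv_mul_cancel₀ two_ne_zero, neg_one_smul]
  exact key (mem_span_odd_words hw)

end Words

/-! ### Generic values of the generators of `S₁` -/

section Generators

variable {k : Type*} [Field k]

theorem add_pow_char_of_sq_zero {p : ℕ} [CharP k p] (hp : p.Prime) {v w : Forms k}
    (hvw : v * w = w * v) (hw : w * w = 0) : (v + w) ^ p = v ^ p := by
  have hp0 : (p : Forms k) = 0 := by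
    rw [← map_natCast (algebraMap k (Forms k)), CharP.cast_eq_zero, map_zero]
  obtain ⟨n, hn⟩ := Nat.exists_eq_add_of_le hp.two_le
  rw [Commute.add_pow_prime_eq hp hvw, hp0, zero_mul, zero_mul, zero_mul, add_zero]
  conv_lhs => rw [hn, pow_add w, sq, hw, zero_mul, add_zero]
  rw [← hn]

theorem mul_x_add_dx_pow {u : Forms k} {i : ℕ} (hu : u * dx k i = 0) (n : ℕ) :
    u * (x k i + dx k i) ^ n = u * x k i ^ n := by
  induction n generalizing u with
  | zero => simp
  | succ n ih =>
    have h : u * x k i * dx k i = 0 := by rw [mul_assoc, x_mul_comm, ← mul_assoc, hu, zero_mul]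
    rw [pow_succ', pow_succ', ← mul_assoc, ← mul_assoc, mul_add, hu, add_zero, ih h]

theorem dx_mul_dx_eq_word (i j : ℕ) : dx k i * dx k j = word k 0 [i, j] := by
  rw [← dx_mul_word, ← dx_mul_word, word_zero_nil, mul_one]

/-- Multiplication by `dx_i dx_j` cancels the odd parts of the powers of `x_i + dx_i` and
`x_j + dx_j`. -/
theorem generic_factor (i j n : ℕ) :
    generic k ((X k i * X k j - X k j * X k i) * X k i ^ n * X k j ^ n) =
      (2 : k) • word k (Finsupp.single i n + Finsupp.single j n) [i, j] := by
  have hi : dx k i * dx k j * dx k i = 0 := by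
    rw [dx_mul_dx, neg_mul, mul_assoc, dx_sq, mul_zero, neg_zero]
  have hj : dx k i * dx k j * x k i ^ n * dx k j = 0 := by
    rw [mul_assoc, x_pow, word, List.map_nil, List.prod_nil, mul_one, poly_mul_comm, mul_assoc,
      ← mul_assoc (dx k j), dx_sq, zero_mul, mul_zero]
  rw [map_mul, map_mul, generic_commutator, map_pow, map_pow, generic_X, generic_X, smul_mul_assoc,
    smul_mul_assoc, mul_x_add_dx_pow hi, mul_x_add_dx_pow hj, dx_mul_dx_eq_word, x_pow, x_pow,
    word_mul_word, word_mul_word, zero_add, List.append_nil, List.append_nil]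

/-- The generic value of a substitution instance of `gen k p t`, in which a lift of the monomial
`x^m` replaces the first variable and variables replace the others. -/
theorem generic_gen [NeZero (2 : k)] {p : ℕ} [CharP k p] (hp : p.Prime) (t : ℕ)
    (ψ : FreeAlg k →ₐ[k] FreeAlg k) (m : ℕ →₀ ℕ) (l : ℕ → ℕ)
    (h0 : generic k (ψ (X k 0)) = word k m [] + d k (word k m []))
    (hl : ∀ s, ψ (X k (s + 1)) = X k (l s)) :
    generic k (ψ (gen k p t)) =
      (2 ^ t : k) • word k (p • m + ∑ s ∈ Finset.range (2 * t), Finsupp.single (l s) (p - 1))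
        ((List.range (2 * t)).map l) := by
  have hprod : ∀ t : ℕ, generic k (ψ ((List.range t).map fun i =>
      (X k (2 * i + 1) * X k (2 * i + 2) - X k (2 * i + 2) * X k (2 * i + 1)) *
        X k (2 * i + 1) ^ (p - 1) * X k (2 * i + 2) ^ (p - 1)).prod) =
      (2 ^ t : k) • word k (∑ s ∈ Finset.range (2 * t), Finsupp.single (l s) (p - 1))
        ((List.range (2 * t)).map l) := by
    intro t
    induction t with
    | zero => simp [word_zero_nil]
    | succ t ih =>
      rw [List.range_succ, List.map_append, List.prod_append, map_mul, map_mul, ih]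
      have h2 : 2 * (t + 1) = 2 * t + 1 + 1 := by ring
      have hfac : generic k (ψ ((X k (2 * t + 1) * X k (2 * t + 2) -
          X k (2 * t + 2) * X k (2 * t + 1)) * X k (2 * t + 1) ^ (p - 1) *
            X k (2 * t + 2) ^ (p - 1))) =
          (2 : k) • word k (Finsupp.single (l (2 * t)) (p - 1) +
            Finsupp.single (l (2 * t + 1)) (p - 1)) [l (2 * t), l (2 * t + 1)] := by
        rw [← generic_factor]
        simp only [map_mul, map_sub, map_pow, hl]
      rw [List.map_singleton, List.prod_singleton, hfac, smul_mul_smul_comm, word_mul_word, h2,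
        Finset.sum_range_succ, Finset.sum_range_succ, List.range_succ, List.range_succ,
        List.map_append, List.map_append, pow_succ, add_assoc, List.append_assoc]
      rfl
  have heven : sgn k (word k m []) = word k m [] := by simp [sgn_word]
  have hpow : (word k m [] + d k (word k m [])) ^ p = word k (p • m) [] := by
    rw [add_pow_char_of_sq_zero hp (even_form_mul heven _)
      (odd_form_sq two_ne_zero (sgn_d_of_even heven))]
    simp [word, ← map_pow, MvPolynomial.monomial_pow]
  rw [gen, map_mul, map_mul, hprod, map_pow, map_pow, h0, hpow, mul_smul_comm, word_mul_word,
    List.nil_append]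

/-! ### Closed forms: the Cartier isomorphism -/

theorem natCast_pow_pred {p : ℕ} [CharP k p] (hp : p.Prime) (n : ℕ) :
    (n : k) ^ (p - 1) = if p ∣ n then 0 else 1 := by
  split_ifs with h
  · rw [(CharP.cast_eq_zero_iff k p n).2 h, zero_pow (Nat.sub_ne_zero_of_lt hp.one_lt)]
  · have hn : (n : k) ≠ 0 := fun hn => h ((CharP.cast_eq_zero_iff k p n).1 hn)
    have : Fact p.Prime := ⟨hp⟩
    have hfrob : (n : k) ^ p = n := by
      have := map_natCast (frobenius k p) n
      rwa [frobenius_def] at this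
    refine mul_right_cancel₀ hn ?_
    rw [← pow_succ, Nat.sub_add_cancel hp.one_le, hfrob, one_mul]

/-- Assumptions on a space `V` of polynomials that are met by `S₁`: it contains the commutators
and the substitution instances of the `gen k p t`. -/
structure IsAdmissible (p : ℕ) (V : Submodule k (FreeAlg k)) : Prop where
  commutator_mem : ∀ f g, f * g - g * f ∈ V
  gen_mem : ∀ (t : ℕ) (ψ : FreeAlg k →ₐ[k] FreeAlg k), ψ (gen k p t) ∈ V

theorem sum_single_apply (l : ℕ → ℕ) (c n i : ℕ) :
    (∑ s ∈ Finset.range n, Finsupp.single (l s) c) i = c * ((List.range n).map l).count i := by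
  induction n with
  | zero => simp
  | succ n ih =>
    rw [Finset.sum_range_succ, Finsupp.add_apply, ih, List.range_succ, List.map_append,
      List.count_append, mul_add, List.map_singleton, List.count_singleton]
    by_cases h : l n = i
    · subst h; simp
    · simp [h]

/-- The monomial forms of weight zero modulo `p` in all variables represent the de Rham cohomology
in characteristic `p`; the even ones are the generic values of the instances of `gen k p t`. -/
theorem word_mem_map_generic [NeZero (2 : k)] {p : ℕ} [CharP k p]
    {V : Submodule k (FreeAlg k)} (hV : IsAdmissible p V) (hp : p.Prime)
    {a : ℕ →₀ ℕ} {L : List ℕ} (hL : Even L.length) (hdvd : ∀ i, p ∣ a i + L.count i) :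
    word k a L ∈ V.map (generic k).toLinearMap := by
  by_cases hnd : L.Nodup
  swap
  · rw [word_eq_zero hnd]; exact zero_mem _
  obtain ⟨t, ht⟩ := hL
  -- `a = p m + (p - 1) 1_L`: as `L` has no repetitions, `a i ≡ -1` for `i ∈ L`, else `a i ≡ 0`
  let m : ℕ →₀ ℕ := a.mapRange (fun n => n / p) (Nat.zero_div p)
  let l : ℕ → ℕ := fun s => L.getD s 0
  have hl : (List.range (2 * t)).map l = L := by
    refine List.ext_getElem (by simp; omega) fun n h1 h2 => ?_
    simp [l, h2]
  have ha : p • m + ∑ s ∈ Finset.range (2 * t), Finsupp.single (l s) (p - 1) = a := by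
    ext i
    rw [Finsupp.add_apply, sum_single_apply, hl, Finsupp.smul_apply, Finsupp.mapRange_apply,
      smul_eq_mul]
    have hp1 := hp.one_lt
    obtain ⟨c, hc⟩ := hdvd i
    rcases Nat.lt_or_ge (L.count i) 1 with h | h
    · have h0 : L.count i = 0 := by omega
      rw [h0, mul_zero, add_zero]
      rw [h0, add_zero] at hc
      rw [Nat.mul_div_cancel' ⟨c, hc⟩]
    · have h1 : L.count i = 1 := le_antisymm (List.nodup_iff_count_le_one.1 hnd i) h
      rw [h1] at hc ⊢
      rw [mul_one]
      have hmod : a i % p = p - 1 := by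
        cases c with
        | zero => omega
        | succ c =>
          have : a i = p - 1 + p * c := by rw [mul_add, mul_one] at hc; omega
          rw [this, Nat.add_mul_mod_self_left, Nat.mod_eq_of_lt (by omega)]
      have := Nat.div_add_mod (a i) p
      omega
  obtain ⟨h, hh⟩ := mem_realized.1
    (even_mem_realized (k := k) (w := word k m []) (by simp [sgn_word]))
  let ψ : FreeAlg k →ₐ[k] FreeAlg k :=
    FreeAlgebra.lift k fun i => if i = 0 then h else X k (l (i - 1))
  have h0 : ψ (X k 0) = h := by simp [ψ, X]
  have hs : ∀ s, ψ (X k (s + 1)) = X k (l s) := fun s => by simp [ψ, X]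
  have key := generic_gen (p := p) hp t ψ m l (by rw [h0, hh]) hs
  rw [ha, hl] at key
  have h2 : (2 ^ t : k) ≠ 0 := pow_ne_zero _ two_ne_zero
  refine ⟨(2 ^ t : k)⁻¹ • ψ (gen k p t), V.smul_mem _ (hV.gen_mem t ψ), ?_⟩
  rw [AlgHom.toLinearMap_apply, map_smul, key, smul_smul, inv_mul_cancel₀ h2, one_smul]

/-- The even forms that are closed up to forms vanishing at all points. -/
noncomputable def closedEven (k : Type*) [Field k] [NeZero (2 : k)] : Submodule k (Forms k) :=
  LinearMap.eqLocus (sgn k).toLinearMap .id ⊓ (vanishing k).comap (d k)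

theorem mem_closedEven [NeZero (2 : k)] {w : Forms k} :
    w ∈ closedEven k ↔ sgn k w = w ∧ d k w ∈ vanishing k := Iff.rfl

theorem lie_mem_closedEven [NeZero (2 : k)] (i : ℕ) {w : Forms k} (hw : w ∈ closedEven k) :
    lie k i w ∈ closedEven k := by
  rw [mem_closedEven] at hw ⊢
  rw [sgn_lie, hw.1, d_lie]
  exact ⟨rfl, d_mem_vanishing (euler_mem_vanishing i hw.2)⟩

/-- By Cartan's formula a Lie derivative of a closed form is exact. -/
theorem lie_mem [NeZero (2 : k)] {p : ℕ}
    {V : Submodule k (FreeAlg k)} (hV : IsAdmissible p V) (i : ℕ)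
    {w : Forms k} (hw : w ∈ closedEven k) :
    lie k i w ∈ V.map (generic k).toLinearMap ⊔ vanishing k := by
  rw [mem_closedEven] at hw
  rw [lie_apply]
  exact Submodule.add_mem_sup
    (d_odd_mem_map_generic V hV.commutator_mem (by rw [sgn_euler, hw.1]))
    (euler_mem_vanishing i hw.2)

theorem lie_pow_word (i n : ℕ) (a : ℕ →₀ ℕ) (L : List ℕ) :
    (lie k i ^ n) (word k a L) = ((a i + L.count i : ℕ) : k) ^ n • word k a L := by
  induction n with
  | zero => simp
  | succ n ih => rw [pow_succ', Module.End.mul_apply, ih, map_smul, lie_word, smul_smul, pow_succ]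

theorem lie_pow_mem_closedEven [NeZero (2 : k)] (i n : ℕ) {w : Forms k} (hw : w ∈ closedEven k) :
    (lie k i ^ n) w ∈ closedEven k := by
  induction n with
  | zero => exact hw
  | succ n ih => rw [pow_succ', Module.End.mul_apply]; exact lie_mem_closedEven i ih

/-- The span of the even monomial forms whose weights in the variables of index in `s` are
divisible by `p`. -/
noncomputable def weightZero (k : Type*) [Field k] (p : ℕ) (s : Set ℕ) : Submodule k (Forms k) :=
  Submodule.span k
    {v | ∃ a L, Even L.length ∧ (∀ i ∈ s, p ∣ a i + L.count i) ∧ v = word k a L}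

theorem weightZero_anti {p : ℕ} {s t : Set ℕ} (h : s ⊆ t) :
    weightZero k p t ≤ weightZero k p s := by
  refine Submodule.span_mono ?_
  rintro _ ⟨a, L, hL, ht, rfl⟩
  exact ⟨a, L, hL, fun i hi => ht i (h hi), rfl⟩

/-- The operator `1 - L_i^(p-1)`, with `L_i` the Lie derivative, projects to the forms of weight
zero in the variable `x_i`. -/
theorem sub_lie_pow_mem_weightZero {p : ℕ} [CharP k p] (hp : p.Prime) (i : ℕ) {s : Set ℕ}
    {w : Forms k} (hw : w ∈ weightZero k p s) :
    w - (lie k i ^ (p - 1)) w ∈ weightZero k p (insert i s) := by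
  induction hw using Submodule.span_induction with
  | mem w hw =>
    obtain ⟨a, L, hL, hs, rfl⟩ := hw
    rw [lie_pow_word, natCast_pow_pred hp]
    split_ifs with h
    · rw [zero_smul, sub_zero]
      refine Submodule.subset_span ⟨a, L, hL, ?_, rfl⟩
      rintro j (rfl | hj)
      exacts [h, hs j hj]
    · rw [one_smul, sub_self]; exact zero_mem _
  | zero => simp
  | add v w _ _ hv hw => rw [map_add, add_sub_add_comm]; exact add_mem hv hw
  | smul c w _ hw => rw [map_smul, ← smul_sub]; exact Submodule.smul_mem _ _ hw

theorem exists_mem_weightZero [NeZero (2 : k)] {p : ℕ} {w : Forms k} (hw : sgn k w = w) :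
    ∃ M, w ∈ weightZero k p {i | M ≤ i} := by
  have hspan := mem_span_even_words hw
  clear hw
  induction hspan using Submodule.span_induction with
  | mem w hw =>
    obtain ⟨a, L, hL, rfl⟩ := hw
    refine ⟨(a.support ∪ L.toFinset).sup id + 1, Submodule.subset_span ⟨a, L, hL, ?_, rfl⟩⟩
    intro i hi
    have hnot : i ∉ a.support ∪ L.toFinset := fun h => by
      have := Finset.le_sup (f := id) h
      simp only [id, Set.mem_ofPred_eq] at this hi
      omega
    simp only [Finset.mem_union, Finsupp.mem_support_iff, List.mem_toFinset, not_or,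
      not_not] at hnot
    rw [hnot.1, List.count_eq_zero.2 hnot.2]
    exact dvd_zero p
  | zero => exact ⟨0, zero_mem _⟩
  | add v w _ _ hv hw =>
    obtain ⟨M, hM⟩ := hv
    obtain ⟨N, hN⟩ := hw
    exact ⟨max M N, add_mem
      (weightZero_anti (fun i (hi : max M N ≤ i) => (le_max_left _ _).trans hi) hM)
      (weightZero_anti (fun i (hi : max M N ≤ i) => (le_max_right _ _).trans hi) hN)⟩
  | smul c w _ hw =>
    obtain ⟨M, hM⟩ := hw
    exact ⟨M, Submodule.smul_mem _ c hM⟩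

theorem closedEven_le [NeZero (2 : k)] {p : ℕ} [CharP k p]
    {V : Submodule k (FreeAlg k)} (hV : IsAdmissible p V) (hp : p.Prime) :
    closedEven k ≤ V.map (generic k).toLinearMap ⊔ vanishing k := by
  intro w hw
  obtain ⟨M, hM⟩ := exists_mem_weightZero (p := p) (mem_closedEven.1 hw).1
  have key : ∀ N, ∃ v ∈ closedEven k, v ∈ weightZero k p {i | i < N ∨ M ≤ i} ∧
      w - v ∈ V.map (generic k).toLinearMap ⊔ vanishing k := by
    intro N
    induction N with
    | zero => exact ⟨w, hw, by simpa using hM, by rw [sub_self]; exact zero_mem _⟩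
    | succ N ih =>
      obtain ⟨v, hv, hvz, hwv⟩ := ih
      refine ⟨v - (lie k N ^ (p - 1)) v, sub_mem hv (lie_pow_mem_closedEven N _ hv),
        weightZero_anti ?_ (sub_lie_pow_mem_weightZero hp N hvz), ?_⟩
      · intro i hi
        simp only [Set.mem_ofPred_eq, Set.mem_insert_iff] at hi ⊢
        omega
      · have hlie : (lie k N ^ (p - 1)) v ∈ V.map (generic k).toLinearMap ⊔ vanishing k := by
          obtain ⟨n, hn⟩ := Nat.exists_eq_add_of_lt hp.one_lt
          rw [hn, add_tsub_cancel_right, Nat.add_comm 1 n, pow_succ', Module.End.mul_apply]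
          exact lie_mem hV N (lie_pow_mem_closedEven N n hv)
        rw [← sub_add]
        exact add_mem hwv hlie
  obtain ⟨v, -, hvz, hwv⟩ := key M
  have hv : v ∈ V.map (generic k).toLinearMap := by
    refine Submodule.span_le.2 ?_ hvz
    rintro _ ⟨a, L, hL, hdvd, rfl⟩
    exact word_mem_map_generic hV hp hL fun i => hdvd i (lt_or_ge i M)
  rw [← sub_add_cancel w v]
  exact add_mem hwv (Submodule.mem_sup_left hv)

/-- A polynomial with central values has a generic value `w + dw` whose odd part `dw` vanishes at
all points, so `w` is closed up to such forms. -/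
theorem mem_of_forall_mem_center [NeZero (2 : k)] {p : ℕ} [CharP k p]
    {V : Submodule k (FreeAlg k)} (hV : IsAdmissible p V)
    (hp : p.Prime) {f : FreeAlg k}
    (hf : ∀ φ : FreeAlg k →ₐ[k] Grassmann k, φ f ∈ Subalgebra.center k (Grassmann k)) :
    f ∈ V ⊔ identities k (Grassmann k) := by
  obtain ⟨w, hw, hfw⟩ := exists_generic_eq f
  have hdw : d k w ∈ vanishing k := by
    have h := forall_mem_center_iff.1 hf
    have h2 : sgn k (generic k f) - generic k f = (-2 : k) • d k w := by
      rw [hfw, map_add, hw, sgn_d_of_even hw, neg_smul, two_smul]; abel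
    rw [h2] at h
    exact (Submodule.smul_mem_iff _ (neg_ne_zero.2 two_ne_zero)).1 h
  obtain ⟨v, ⟨g, hg, rfl⟩, u, hu, hvu⟩ :=
    Submodule.mem_sup.1 (closedEven_le hV hp (mem_closedEven.2 ⟨hw, hdw⟩))
  rw [← add_sub_cancel g f]
  refine Submodule.add_mem_sup hg (mem_identities_iff.2 ?_)
  have h : generic k (f - g) = u + d k w := by
    rw [map_sub, hfw, sub_eq_iff_eq_add, ← AlgHom.toLinearMap_apply (generic k) g]
    nth_rewrite 1 [← hvu]
    abel
  rw [h]
  exact add_mem hu hdw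

end Generators

/-! ### The space of central polynomials -/

section Central

variable {k : Type*} [Field k]

theorem tSpan_le {A : Type*} [Ring A] [Algebra k A] {B : Set A} {V : Submodule k A}
    (hV : IsTSpace V) (hB : B ⊆ V) : tSpan k B ≤ V :=
  sInf_le ⟨hV, hB⟩

theorem isTSpace_sup {A : Type*} [Ring A] [Algebra k A] {V W : Submodule k A}
    (hV : IsTSpace V) (hW : IsTSpace W) : IsTSpace (V ⊔ W) := by
  intro φ f hf
  obtain ⟨v, hv, w, hw, rfl⟩ := Submodule.mem_sup.1 hf
  rw [map_add]
  exact Submodule.add_mem_sup (hV φ v hv) (hW φ w hw)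

theorem isTSpace_identities (A : Type*) [Ring A] [Algebra k A] :
    IsTSpace (identities k A) := by
  intro φ f hf
  simp only [identities, Submodule.mem_iInf, LinearMap.mem_ker, AlgHom.toLinearMap_apply] at hf ⊢
  exact fun χ => hf (χ.comp φ)

theorem isTSpace_S₁ (p : ℕ) : IsTSpace (S₁ k p) :=
  isTSpace_sup (isTSpace_tSpan _) (isTSpace_tSpan _)

/-- Adding `1` turns an identity into a central polynomial, so all polynomials with central values
belong to the space generated by the central polynomials. -/
theorem mem_CP {A : Type*} [Ring A] [Algebra k A] [Nontrivial A] {f : FreeAlg k}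
    (hf : ∀ φ : FreeAlg k →ₐ[k] A, φ f ∈ Subalgebra.center k A) : f ∈ CP k A := by
  have hone : (1 : FreeAlg k) ∉ identities k A := by
    intro h
    simp only [identities, Submodule.mem_iInf, LinearMap.mem_ker, AlgHom.toLinearMap_apply,
      map_one] at h
    exact one_ne_zero (h (FreeAlgebra.lift k fun _ => 0))
  have hc : ∀ f : FreeAlg k, f ∉ identities k A →
      (∀ φ : FreeAlg k →ₐ[k] A, φ f ∈ Subalgebra.center k A) → f ∈ CP k A :=
    fun f h1 h2 => subset_tSpan _ ⟨h1, h2⟩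
  by_cases h : f ∈ identities k A
  · rw [← add_sub_cancel_right f 1]
    refine sub_mem (hc _ (fun h' => hone ?_) fun φ => ?_) (hc 1 hone fun φ => ?_)
    · simpa using sub_mem h' h
    · rw [map_add, map_one]; exact add_mem (hf φ) (one_mem _)
    · rw [map_one]; exact one_mem _
  · exact hc f h hf

theorem identities_le_CP (A : Type*) [Ring A] [Algebra k A] [Nontrivial A] :
    identities k A ≤ CP k A := by
  intro f hf
  refine mem_CP fun φ => ?_
  simp only [identities, Submodule.mem_iInf, LinearMap.mem_ker, AlgHom.toLinearMap_apply] at hf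
  rw [hf φ]
  exact zero_mem _

theorem gen_mem_S₁ (p t : ℕ) : gen k p t ∈ S₁ k p := by
  rcases Nat.eq_zero_or_pos t with rfl | ht
  · refine Submodule.mem_sup_left (subset_tSpan _ ?_)
    simp [gen]
  · exact Submodule.mem_sup_right (subset_tSpan _ ⟨t, ht, rfl⟩)

theorem isAdmissible_S₁ (p : ℕ) : IsAdmissible p (S₁ k p) where
  commutator_mem f g := by
    have h : X k 0 * X k 1 - X k 1 * X k 0 ∈ S₁ k p :=
      Submodule.mem_sup_left (subset_tSpan _ (Or.inl rfl))
    have := isTSpace_S₁ p (FreeAlgebra.lift k fun i => if i = 0 then f else g) _ h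
    simpa [X] using this
  gen_mem t ψ := isTSpace_S₁ p ψ _ (gen_mem_S₁ p t)

theorem S₁_le_CP [NeZero (2 : k)] {p : ℕ} [CharP k p] (hp : p.Prime) :
    S₁ k p ≤ CP k (Grassmann k) := by
  have hcentral : ∀ f : FreeAlg k, sgn k (generic k f) = generic k f →
      f ∈ CP k (Grassmann k) := by
    intro f hf
    refine mem_CP (forall_mem_center_iff.2 ?_)
    rw [hf, sub_self]
    exact zero_mem _
  have hgen : ∀ t, gen k p t ∈ CP k (Grassmann k) := by
    intro t
    have hX : generic k (AlgHom.id k _ (X k 0)) =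
        word k (Finsupp.single 0 1) [] + d k (word k (Finsupp.single 0 1) []) := by
      have h := d_x_mul (k := k) 0 1
      rw [mul_one, d_one, mul_zero, add_zero, mul_one] at h
      rw [← x_pow, pow_one, h, AlgHom.id_apply, generic_X]
    have h := generic_gen hp t (AlgHom.id k _) (Finsupp.single 0 1) Nat.succ hX fun s => rfl
    rw [AlgHom.id_apply] at h
    refine hcentral _ ?_
    rw [h, map_smul, sgn_word, List.length_map, List.length_range, (even_two_mul t).neg_one_pow,
      one_mul]
  refine sup_le (tSpan_le (isTSpace_tSpan _) ?_) (tSpan_le (isTSpace_tSpan _) ?_)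
  · rintro f (rfl | rfl)
    · refine hcentral _ ?_
      rw [generic_commutator, map_smul, map_mul, sgn_dx, sgn_dx, neg_mul_neg]
    · simpa [gen] using hgen 0
  · rintro f ⟨t, -, rfl⟩
    exact hgen t

theorem CP_eq [NeZero (2 : k)] {p : ℕ} [CharP k p] (hp : p.Prime) :
    CP k (Grassmann k) = S₁ k p ⊔ identities k (Grassmann k) :=
  le_antisymm
    (tSpan_le (isTSpace_sup (isTSpace_S₁ p) (isTSpace_identities _)) fun _ hf =>
      mem_of_forall_mem_center (isAdmissible_S₁ p) hp hf.2)
    (sup_le (S₁_le_CP hp) (identities_le_CP _))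

/-- In characteristic two `e_i e_j = e_j e_i`, so the Grassmann algebra is commutative. -/
theorem CP_eq_top [CharP k 2] : CP k (Grassmann k) = ⊤ := by
  refine eq_top_iff.2 fun f _ => mem_CP fun φ => (mem_center_iff _).2 ?_
  refine mem_of_e_mul_mem (LinearMap.eqLocus (parity k).toLinearMap .id) (by simp) ?_ (φ f)
  intro i z hz
  simp only [LinearMap.mem_eqLocus, AlgHom.toLinearMap_apply, LinearMap.id_apply, map_mul,
    parity_e] at hz ⊢
  have h : -e k i = e k i := by
    rw [neg_eq_iff_add_eq_zero, ← two_smul k, CharTwo.two_eq_zero, zero_smul]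
  rw [hz, h]

end Central

end GrassmannPI

theorem theorem4p1 (k : Type*) [Field k] [Finite k] (p : ℕ) [CharP k p] :
    (2 < p → GrassmannPI.CP k (GrassmannPI.Grassmann k) =
      GrassmannPI.S₁ k p ⊔ GrassmannPI.identities k (GrassmannPI.Grassmann k)) ∧
    (p = 2 → GrassmannPI.CP k (GrassmannPI.Grassmann k) = ⊤) := by
  refine ⟨fun h2 => ?_, ?_⟩
  · have hp : p.Prime := (CharP.char_is_prime_or_zero k p).resolve_right (by omega)
    have : NeZero (2 : k) := ⟨fun h => by
      have := Nat.le_of_dvd two_pos ((CharP.cast_eq_zero_iff k p 2).1 (by exact_mod_cast h))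
      omega⟩
    exact GrassmannPI.CP_eq hp
  · rintro rfl
    exact GrassmannPI.CP_eq_top
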